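/- Let $r\ge 0$ be an integer and let $\Gamma$ be a multigraph without loops (multiple edges are allowed, and no finiteness is required). If $r$ is odd, assume moreover that every edge of $\Gamma$ is oriented, i.e. its two end vertices are ordered. A \emph{circuit} $w$ in such a graph consists of edges $w_1,\dots,w_k$ $(k\ge 1)$ and vertices $v_1,\dots,v_k,v_{k+1}=v_1$ such that $v_i,v_{i+1}$ are the two end vertices of $w_i$ for every $i$; edges and vertices may be repeated. Let $\Lambda^r(\Gamma)$ be the following ring with one generator $e_\alpha$ (of degree $r-1$) for each edge $\alpha$ of $\Gamma$: if $r$ is even, the exterior algebra over $\mathbb Z$ on the generators $e_\alpha$; if $r$ is odd, the commutative ring $\mathbb Z[e_\alpha]/(e_\alpha^2)$. Writing $w_i$ also for the generator $e_{w_i}$, the \emph{Arnold class} of a circuit $w$ is $$A(w)=\sum_{i=1}^{k}(-1)^i\,w_1\cdots\widehat{w_i}\cdots w_k\ \text{ if } r \text{ is even},\qquad A(w)=\sum_{i=1}^{k}\epsilon_i(w)\,w_1\cdots\widehat{w_i}\cdots w_k\ \text{ if } r \text{ is odd},$$ where $\epsilon_i(w)=1$ if the orientation of the edge $w_i$ goes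 from $v_i$ to $v_{i+1}$, and $\epsilon_i(w)=-1$ otherwise. Let $I^r(\Gamma)$ be the two-sided ideal of $\Lambda^r(\Gamma)$ generated by the Arnold classes of all circuits of $\Gamma$, and let $R^r(\Gamma)=\Lambda^r(\Gamma)/I^r(\Gamma)$. Let $\Gamma'$ be a subgraph of $\Gamma$ with the same vertex set, $V(\Gamma')=V(\Gamma)$, with the orientation inherited from $\Gamma$ if $r$ is odd. Then the ring homomorphism $i_*:R^r(\Gamma')\to R^r(\Gamma)$ induced by the inclusion, which sends $e_\alpha$ to $e_\alpha$ for every edge $\alpha$ of $\Gamma'$, is injective. -/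

import Mathlib

open scoped Graph

noncomputable section

namespace GraphRing

universe u v

variable {α : Type u} {β : Type v}

/-- The defining relations of `Λ^r` on a set `E` of generators of degree `r - 1`: graded
commutativity (the sign `(-1)^((r-1)(r-1))` equals `(-1)^(r+1)`), and squares of generators
vanish. -/
inductive LambdaRel (r : ℕ) (E : Type v) : FreeAlgebra ℤ E → FreeAlgebra ℤ E → Prop
  | comm (a b : E) : LambdaRel r E (FreeAlgebra.ι ℤ a * FreeAlgebra.ι ℤ b)
      ((-1) ^ (r + 1) * (FreeAlgebra.ι ℤ b * FreeAlgebra.ι ℤ a))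
  | sq (a : E) : LambdaRel r E (FreeAlgebra.ι ℤ a * FreeAlgebra.ι ℤ a) 0

/-- The algebra `Λ^r` over `ℤ` on a set `E` of generators of degree `r - 1`: the exterior algebra
on `E` if `r` is even, the commutative algebra `ℤ[e | e ∈ E] / (e² | e ∈ E)` if `r` is odd. -/
abbrev Lambda (r : ℕ) (E : Type v) : Type v := RingQuot (LambdaRel r E)

/-- The generator of `Λ^r` given by `a`. -/
def gen (r : ℕ) {E : Type v} (a : E) : Lambda r E :=
  RingQuot.mkRingHom (LambdaRel r E) (FreeAlgebra.ι ℤ a)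

theorem gen_comm (r : ℕ) {E : Type v} (a b : E) :
    gen r a * gen r b = (-1) ^ (r + 1) * (gen r b * gen r a) := by
  simpa [gen] using RingQuot.mkRingHom_rel (LambdaRel.comm (r := r) a b)

theorem gen_sq (r : ℕ) {E : Type v} (a : E) : gen r a * gen r a = 0 := by
  simpa [gen] using RingQuot.mkRingHom_rel (LambdaRel.sq (r := r) a)

/-- The ring map `Λ^r(E) → Λ^r(F)` induced by a map of generating sets. -/
def lambdaMap (r : ℕ) {E F : Type v} (f : E → F) : Lambda r E →+* Lambda r F :=
  RingQuot.lift ⟨(FreeAlgebra.lift ℤ fun a => gen r (f a)).toRingHom, by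
    intro x y h
    cases h with
    | comm a b => simpa using gen_comm r (f a) (f b)
    | sq a => simpa using gen_sq r (f a)⟩

@[simp] theorem lambdaMap_gen (r : ℕ) {E F : Type v} (f : E → F) (a : E) :
    lambdaMap r f (gen r a) = gen r (f a) := by
  unfold lambdaMap
  rw [gen, RingQuot.lift_mkRingHom_apply]
  simp

/-- An orientation of a multigraph: an ordering of the two ends of every edge. -/
structure Orientation (G : Graph α β) where
  /-- The first end of an edge. -/
  tail : E(G) → α
  /-- The second end of an edge. -/
  head : E(G) → α
  isLink : ∀ e : E(G), G.IsLink e (tail e) (head e)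

/-- The orientation of a subgraph obtained by restriction. -/
def Orientation.restrict {G H : Graph α β} (o : Orientation G) (h : H ≤ G) : Orientation H where
  tail e := o.tail (Set.inclusion h.edgeSet_mono e)
  head e := o.head (Set.inclusion h.edgeSet_mono e)
  isLink e := (h.isLink_iff e.2).2 (o.isLink (Set.inclusion h.edgeSet_mono e))

/-- A step along an edge of a multigraph, from one end of the edge to the other. -/
structure Step (G : Graph α β) where
  /-- The vertex where the step starts. -/
  src : α
  /-- The edge of the step. -/
  edge : E(G)
  /-- The vertex where the step arrives. -/
  tgt : α
  isLink : G.IsLink edge src tgt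

/-- The steps `(v₁, w₁, v₂), (v₂, w₂, v₃), …, (v_k, w_k, v₁)`, with `k ≥ 1`, form a circuit. Edges
and vertices may be repeated. -/
def IsCircuit {G : Graph α β} (w : List (Step G)) : Prop :=
  w.IsChain (fun s t => s.tgt = t.src) ∧
    ∃ h : w ≠ [], (w.getLast h).tgt = (w.head h).src

open Classical in
/-- The coefficient of `w₁ ⋯ ŵ_i ⋯ w_k` in the Arnold class of a circuit, where `s` is the `i`-th
step of the circuit: `(-1)^i` if `r` is even; if `r` is odd, `1` or `-1` according to whether the
edge is traversed along its orientation or against it. An orientation is given only for odd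
`r`. -/
def arnoldSign (r : ℕ) {G : Graph α β} (o : Odd r → Orientation G) (i : ℕ) (s : Step G) : ℤ :=
  if h : Odd r then (if (o h).tail s.edge = s.src then 1 else -1) else (-1) ^ i

/-- The Arnold class `A(w) = ∑ᵢ ± w₁ ⋯ ŵ_i ⋯ w_k` of a sequence `w` of steps. The positions in a
list are numbered from `0`, hence the `i + 1`. -/
def arnoldClass (r : ℕ) {G : Graph α β} (o : Odd r → Orientation G) (w : List (Step G)) :
    Lambda r E(G) :=
  ∑ i : Fin w.length,
    arnoldSign r o (i + 1) w[i] • ((w.eraseIdx i).map fun s => gen r s.edge).prod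

/-- The generalized Arnold ideal `I^r(Γ)`, generated by the Arnold classes of all circuits. -/
def arnoldIdeal (r : ℕ) (G : Graph α β) (o : Odd r → Orientation G) :
    TwoSidedIdeal (Lambda r E(G)) :=
  TwoSidedIdeal.span {x | ∃ w : List (Step G), IsCircuit w ∧ arnoldClass r o w = x}

/-- The quotient ring `R^r(Γ) = Λ^r(Γ) / I^r(Γ)`. -/
abbrev R (r : ℕ) (G : Graph α β) (o : Odd r → Orientation G) : Type v :=
  (arnoldIdeal r G o).ringCon.Quotient

/-- The inclusion of a subgraph, on steps. -/
def Step.incl {G H : Graph α β} (h : H ≤ G) (s : Step H) : Step G where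
  src := s.src
  edge := Set.inclusion h.edgeSet_mono s.edge
  tgt := s.tgt
  isLink := s.isLink.mono h

theorem isCircuit_incl {G H : Graph α β} (h : H ≤ G) {w : List (Step H)} (hw : IsCircuit w) :
    IsCircuit (w.map (Step.incl h)) := by
  obtain ⟨hc, hne, hcl⟩ := hw
  refine ⟨?_, by simpa using hne, ?_⟩
  · rw [List.isChain_map]
    exact hc
  · rw [List.getLast_map, List.head_map]
    exact hcl

theorem lambdaMap_arnoldClass (r : ℕ) {G H : Graph α β} (o : Odd r → Orientation G) (h : H ≤ G)
    (w : List (Step H)) :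
    lambdaMap r (Set.inclusion h.edgeSet_mono) (arnoldClass r (fun hr => (o hr).restrict h) w) =
      arnoldClass r o (w.map (Step.incl h)) := by
  unfold arnoldClass
  rw [map_sum]
  refine Fintype.sum_equiv (finCongr (by simp)) _ _ fun i => ?_
  rw [map_zsmul, map_list_prod, List.map_map]
  have hi : (w.map (Step.incl h))[(finCongr (by simp) i : Fin (w.map (Step.incl h)).length)] =
      Step.incl h w[i] := by simp
  have hs : arnoldSign r o (i + 1) (Step.incl h w[i]) =
      arnoldSign r (fun hr => (o hr).restrict h) (i + 1) w[i] := rfl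
  rw [hi, finCongr_apply_coe, hs]
  simp [List.eraseIdx_map, Function.comp_def, Step.incl]

theorem arnoldIdeal_le_ker (r : ℕ) {G H : Graph α β} (o : Odd r → Orientation G) (h : H ≤ G) :
    (arnoldIdeal r H fun hr => (o hr).restrict h).ringCon ≤
      RingCon.ker ((arnoldIdeal r G o).ringCon.mk'.comp
        (lambdaMap r (Set.inclusion h.edgeSet_mono))) := by
  have key : arnoldIdeal r H (fun hr => (o hr).restrict h) ≤
      TwoSidedIdeal.ker ((arnoldIdeal r G o).ringCon.mk'.comp
        (lambdaMap r (Set.inclusion h.edgeSet_mono))) := by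
    refine TwoSidedIdeal.span_le.2 ?_
    rintro _ ⟨w, hw, rfl⟩
    rw [SetLike.mem_coe, TwoSidedIdeal.mem_ker, RingHom.comp_apply, lambdaMap_arnoldClass,
      ← map_zero (arnoldIdeal r G o).ringCon.mk']
    exact (RingCon.eq _).2 ((TwoSidedIdeal.mem_iff _ _).1
      (TwoSidedIdeal.subset_span ⟨_, isCircuit_incl h hw, rfl⟩))
  exact TwoSidedIdeal.ringCon_le_iff.1 key

/-- The ring map `R^r(Γ') → R^r(Γ)` induced by the inclusion of a subgraph `Γ'` of `Γ`. -/
def inclusionMap (r : ℕ) {G H : Graph α β} (o : Odd r → Orientation G) (h : H ≤ G) :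
    R r H (fun hr => (o hr).restrict h) →+* R r G o :=
  (arnoldIdeal r H fun hr => (o hr).restrict h).ringCon.lift
    ((arnoldIdeal r G o).ringCon.mk'.comp (lambdaMap r (Set.inclusion h.edgeSet_mono)))
    (arnoldIdeal_le_ker r o h)

/-- The class in `R^r(Γ)` of the generator given by an edge of `Γ`. -/
def edgeClass (r : ℕ) (G : Graph α β) (o : Odd r → Orientation G) (e : E(G)) : R r G o :=
  (arnoldIdeal r G o).ringCon.mk' (gen r e)

theorem inclusionMap_edgeClass (r : ℕ) {G H : Graph α β} (o : Odd r → Orientation G) (h : H ≤ G)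
    (e : E(H)) :
    inclusionMap r o h (edgeClass r H (fun hr => (o hr).restrict h) e) =
      edgeClass r G o (Set.inclusion h.edgeSet_mono e) := by
  unfold inclusionMap edgeClass
  rw [RingCon.lift_mk', RingHom.comp_apply, lambdaMap_gen]

end GraphRing

end

/-! The ring `R^r(Γ)` embeds in a ring that depends only on the vertices. Put `q = (-1)^(r+1)`. The
ring `Conf q α` has a generator for every ordered pair of points, subject to Arnold's three-term
relation, and an edge from `a` to `b` is sent to `conf q a b`. For loopless `Γ` the kernel of
`Λ^r(Γ) → Conf` is exactly `I^r(Γ)` (`mem_arnoldIdeal_iff`). The map for `Γ'` is the one for `Γ`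
composed with `Λ^r(Γ') → Λ^r(Γ)`, so an element of `Λ^r(Γ')` that falls into `I^r(Γ)` already lies
in `I^r(Γ')`.

Circuits die in `Conf` because the product along a walk from `a` to `b` equals `conf q a b` times
its boundary (`Walk.prod_conf`, `Walk.boundary_conf`).

The converse, `mem_circuitIdeal_of_map_eq_zero`, is a deletion-contraction induction on a finite
edge set supporting the element. Write the element as `a + x f * b`, with `a` and `b` free of the
edge `f`. A residue along the ends of `f` (`confResidue`) shows that `b` dies in `Conf` after the
contraction of `f`, so by induction `b` is a combination of circuits of the contraction. These lift
(`liftable_of_mem_circuitIdeal`): modulo circuits, `x f * b` becomes an element `-c` free of `f`.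
Then `a - c` lies in the kernel for the deletion of `f`, and induction applies again. Contraction
may create loops, so the induction allows them; a loop makes the circuit ideal everything. -/

noncomputable section

namespace GraphRing

universe u v

/-! ### Boundaries of products in a ring with commutation sign `q`. -/

section Boundary

variable {A B : Type*} [Ring A] [Ring B]

/-- The sum `∑ᵢ q^i x₀ ⋯ x̂ᵢ ⋯ x_k`, for a sequence `x` of elements of a ring. -/
def boundary (q : ℤ) : List A → A
  | [] => 0
  | x :: l => l.prod + q • (x * boundary q l)

@[simp] theorem boundary_nil (q : ℤ) : boundary q ([] : List A) = 0 := rfl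

@[simp] theorem boundary_cons (q : ℤ) (x : A) (l : List A) :
    boundary q (x :: l) = l.prod + q • (x * boundary q l) := rfl

theorem map_boundary (q : ℤ) (f : A →+* B) (l : List A) :
    f (boundary q l) = boundary q (l.map f) := by
  induction l with
  | nil => simp
  | cons x l ih => simp [ih, map_list_prod]

theorem boundary_append (q : ℤ) (l m : List A) :
    boundary q (l ++ m) = boundary q l * m.prod + q ^ l.length • (l.prod * boundary q m) := by
  induction l with
  | nil => simp
  | cons x l ih =>
    simp only [List.cons_append, boundary_cons, List.prod_append, ih, List.prod_cons,
      List.length_cons, pow_succ', mul_smul, mul_add, add_mul, smul_add, mul_assoc,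
      mul_smul_comm, smul_mul_assoc]
    abel

theorem mul_prod_of_comm {q : ℤ} {x : A} {l : List A} (h : ∀ y ∈ l, x * y = q • (y * x)) :
    x * l.prod = q ^ l.length • (l.prod * x) := by
  induction l with
  | nil => simp
  | cons y l ih =>
    rw [List.prod_cons, ← mul_assoc, h y (by simp), smul_mul_assoc, mul_assoc,
      ih fun z hz => h z (by simp [hz]), List.length_cons, pow_succ', mul_smul, mul_smul_comm,
      mul_assoc]

theorem mul_boundary_of_comm {q : ℤ} (hq : q * q = 1) {x : A} {l : List A}
    (h : ∀ y ∈ l, x * y = q • (y * x)) :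
    x * boundary q l = q ^ (l.length + 1) • (boundary q l * x) := by
  induction l with
  | nil => simp
  | cons y l ih =>
    have hl : ∀ z ∈ l, x * z = q • (z * x) := fun z hz => h z (by simp [hz])
    have e1 : q ^ (l.length + 1 + 1) = q ^ l.length := by rw [pow_succ, pow_succ, mul_assoc, hq,
      mul_one]
    rw [boundary_cons, mul_add, mul_prod_of_comm hl, mul_smul_comm, ← mul_assoc, h y (by simp),
      smul_mul_assoc, mul_assoc, ih hl, List.length_cons, e1, add_mul, smul_add, smul_smul,
      hq, one_smul, mul_smul_comm, smul_mul_assoc, smul_smul, mul_assoc, pow_succ]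

theorem prod_mul_boundary_of_comm {q : ℤ} (hq : q * q = 1) {l m : List A}
    (h : ∀ x ∈ l, ∀ y ∈ m, x * y = q • (y * x)) :
    l.prod * boundary q m = q ^ ((m.length + 1) * l.length) • (boundary q m * l.prod) := by
  induction l with
  | nil => simp
  | cons x l ih =>
    rw [List.prod_cons, mul_assoc, ih fun z hz => h z (by simp [hz]), mul_smul_comm, ← mul_assoc,
      mul_boundary_of_comm hq (h x (by simp)), smul_mul_assoc, smul_smul, mul_assoc,
      List.length_cons, mul_add_one, pow_add _ _ (m.length + 1)]

/-- The boundary of a concatenation, with the boundaries as left factors. -/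
theorem boundary_append_of_comm {q : ℤ} (hq : q * q = 1) {l m : List A}
    (h : ∀ x ∈ l, ∀ y ∈ m, x * y = q • (y * x)) :
    boundary q (l ++ m) =
      boundary q l * m.prod + q ^ (l.length * m.length) • (boundary q m * l.prod) := by
  rw [boundary_append, prod_mul_boundary_of_comm hq h, smul_smul, ← pow_add]
  have : q ^ (l.length + (m.length + 1) * l.length) = q ^ (l.length * m.length) := by
    rw [show l.length + (m.length + 1) * l.length = l.length * m.length + 2 * l.length by ring,
      pow_add, pow_mul q 2, pow_two, hq, one_pow, mul_one]
  rw [this]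

/-- This allows the base point of a circuit to be moved at the cost of a sign. -/
theorem boundary_append_comm {q : ℤ} (hq : q * q = 1) {l m : List A}
    (h : ∀ x ∈ l, ∀ y ∈ m, x * y = q • (y * x)) :
    boundary q (l ++ m) = q ^ (l.length * m.length) • boundary q (m ++ l) := by
  have h' : ∀ x ∈ m, ∀ y ∈ l, x * y = q • (y * x) := fun x hx y hy => by
    rw [h y hy x hx, smul_smul, hq, one_smul]
  have e : q ^ (l.length * m.length) * q ^ (m.length * l.length) = 1 := by
    rw [mul_comm m.length, ← mul_pow, hq, one_pow]
  rw [boundary_append_of_comm hq h, boundary_append_of_comm hq h', smul_add, smul_smul, e,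
    one_smul, add_comm]

end Boundary

/-! ### The Arnold ring of configurations and its residues. -/

section Configuration

/-- The defining relations of the Arnold ring of the configurations of points labelled by `α`. -/
inductive ConfRel (q : ℤ) (α : Type u) :
    FreeAlgebra ℤ (α × α) → FreeAlgebra ℤ (α × α) → Prop
  | comm (x y : α × α) : ConfRel q α (FreeAlgebra.ι ℤ x * FreeAlgebra.ι ℤ y)
      (q * (FreeAlgebra.ι ℤ y * FreeAlgebra.ι ℤ x))
  | sq (x : α × α) : ConfRel q α (FreeAlgebra.ι ℤ x * FreeAlgebra.ι ℤ x) 0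
  | swap (a b : α) : ConfRel q α (FreeAlgebra.ι ℤ (b, a)) (-q * FreeAlgebra.ι ℤ (a, b))
  | self (a : α) : ConfRel q α (FreeAlgebra.ι ℤ (a, a)) 0
  | triangle (a b c : α) : ConfRel q α (FreeAlgebra.ι ℤ (a, b) * FreeAlgebra.ι ℤ (b, c))
      (FreeAlgebra.ι ℤ (a, c) * FreeAlgebra.ι ℤ (b, c) +
        q * (FreeAlgebra.ι ℤ (a, c) * FreeAlgebra.ι ℤ (a, b)))

/-- The Arnold ring of the configurations of points labelled by `α`. -/
def Conf (q : ℤ) (α : Type u) : Type u := RingQuot (ConfRel q α)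

instance (q : ℤ) (α : Type u) : Ring (Conf q α) := inferInstanceAs (Ring (RingQuot (ConfRel q α)))

variable {q : ℤ} {α : Type u}

/-- The quotient map onto the Arnold ring. -/
def confMk (q : ℤ) (α : Type u) : FreeAlgebra ℤ (α × α) →+* Conf q α :=
  RingQuot.mkRingHom (ConfRel q α)

theorem confMk_rel {x y : FreeAlgebra ℤ (α × α)} (h : ConfRel q α x y) :
    confMk q α x = confMk q α y :=
  RingQuot.mkRingHom_rel h

/-- The generator of the Arnold ring given by an ordered pair of points. -/
def conf (q : ℤ) {α : Type u} (a b : α) : Conf q α :=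
  confMk q α (FreeAlgebra.ι ℤ (a, b))

theorem conf_comm (a b c d : α) :
    conf q a b * conf q c d = q • (conf q c d * conf q a b) := by
  simpa [conf] using confMk_rel (ConfRel.comm (q := q) (a, b) (c, d))

theorem conf_sq (a b : α) : conf q a b * conf q a b = 0 := by
  simpa [conf] using confMk_rel (ConfRel.sq (q := q) (a, b))

theorem conf_swap (a b : α) : conf q b a = -q • conf q a b := by
  simpa [conf] using confMk_rel (ConfRel.swap (q := q) a b)

@[simp] theorem conf_self (a : α) : conf q a a = 0 := by
  simpa [conf] using confMk_rel (ConfRel.self (q := q) a)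

theorem conf_triangle (a b c : α) : conf q a b * conf q b c =
    conf q a c * conf q b c + q • (conf q a c * conf q a b) := by
  simpa [conf] using confMk_rel (ConfRel.triangle (q := q) a b c)

/-- A ring map out of the Arnold ring, from the images of the generators. -/
def confLift {A : Type*} [Ring A] (g : α → α → A)
    (comm : ∀ a b c d, g a b * g c d = q • (g c d * g a b)) (sq : ∀ a b, g a b * g a b = 0)
    (swap : ∀ a b, g b a = -q • g a b) (self : ∀ a, g a a = 0)
    (triangle : ∀ a b c, g a b * g b c = g a c * g b c + q • (g a c * g a b)) :
    Conf q α →+* A :=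
  RingQuot.lift ⟨(FreeAlgebra.lift ℤ fun x : α × α => g x.1 x.2).toRingHom, by
    intro x y h
    cases h with
    | comm x y => simpa using comm x.1 x.2 y.1 y.2
    | sq x => simpa using sq x.1 x.2
    | swap a b => simpa using swap a b
    | self a => simpa using self a
    | triangle a b c => simpa using triangle a b c⟩

@[simp] theorem confLift_conf {A : Type*} [Ring A] (g : α → α → A) (comm sq swap self triangle)
    (a b : α) :
    confLift (q := q) g comm sq swap self triangle (conf q a b) = g a b := by
  refine (RingQuot.lift_mkRingHom_apply _ _ _).trans ?_
  simp

/-- The augmentation of the Arnold ring. -/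
def confAug (q : ℤ) (α : Type u) : Conf q α →+* ℤ :=
  confLift (fun _ _ => 0) (by simp) (by simp) (by simp) (by simp) (by simp)

open Classical in
/-- The residue of the generator `conf q a b` along the pair `(u, v)`. -/
def confRes (q : ℤ) (u v a b : α) : ℤ :=
  if a = u ∧ b = v then 1 else if a = v ∧ b = u then -q else 0

open Classical in
/-- The map which identifies the point `v` with the point `u`. -/
def collapse (u v : α) (a : α) : α := if a = v then u else a

theorem collapse_eq {u v a b : α} (h : collapse u v a = collapse u v b) :
    a = b ∨ (a = u ∧ b = v) ∨ (a = v ∧ b = u) := by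
  unfold collapse at h
  split_ifs at h <;> simp_all

@[simp] theorem collapse_left (u v : α) : collapse u v u = u := by
  simp [collapse]

@[simp] theorem collapse_right (u v : α) : collapse u v v = u := by
  simp [collapse]

/-- A generator with nonzero residue collapses to `conf q u u = 0`. This dichotomy is what makes the
residue compatible with the relations. -/
theorem confRes_eq_zero_or (q : ℤ) (u v a b : α) :
    confRes q u v a b = 0 ∨ collapse u v a = collapse u v b := by
  unfold confRes
  split_ifs with h h
  · simp [h]
  · simp [h]
  · simp

theorem confRes_self (q : ℤ) {u v : α} (h : u ≠ v) (a : α) : confRes q u v a a = 0 := by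
  unfold confRes
  rw [if_neg fun h' => h (h'.1.symm.trans h'.2), if_neg fun h' => h (h'.2.symm.trans h'.1)]

theorem confRes_swap (hq : q * q = 1) {u v : α} (h : u ≠ v) (a b : α) :
    confRes q u v b a = -q * confRes q u v a b := by
  unfold confRes
  by_cases h1 : a = u ∧ b = v
  · rw [if_neg fun h' => h (h1.1.symm.trans h'.2), if_pos ⟨h1.2, h1.1⟩, if_pos h1, mul_one]
  · by_cases h2 : a = v ∧ b = u
    · rw [if_pos ⟨h2.2, h2.1⟩, if_neg h1, if_pos h2, neg_mul_neg, hq]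
    · rw [if_neg fun h' => h2 ⟨h'.2, h'.1⟩, if_neg fun h' => h1 ⟨h'.2, h'.1⟩, if_neg h1,
        if_neg h2, mul_zero]

/-- The upper triangular matrix with diagonal entries `q • x`, `x` and scalar entry `d`. -/
def residueMatrix {A : Type*} [Ring A] (q : ℤ) (x : A) (d : ℤ) : Matrix (Fin 2) (Fin 2) A :=
  !![q • x, d • (1 : A); 0, x]

/-- The corner entry follows a twisted Leibniz rule, `d(xy) = q x d(y) + d(x) y`; encoding it in
matrices turns the residue into a ring map. -/
theorem residueMatrix_mul {A : Type*} [Ring A] (hq : q * q = 1) (x y : A) (d e : ℤ) :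
    residueMatrix q x d * residueMatrix q y e = !![x * y, (q * e) • x + d • y; 0, x * y] := by
  unfold residueMatrix
  rw [Matrix.mul_fin_two, mul_smul_comm, smul_mul_assoc, smul_smul, hq, one_smul, mul_zero,
    add_zero, zero_mul, zero_mul, mul_zero, add_zero, zero_add, mul_smul_comm, mul_one,
    smul_mul_assoc, one_mul, smul_smul, mul_comm e]

theorem upper_smul {A : Type*} [Ring A] (q : ℤ) (x y z : A) :
    q • !![x, y; 0, z] = !![q • x, q • y; 0, q • z] := by
  ext i j
  fin_cases i <;> fin_cases j <;> simp

theorem upper_add {A : Type*} [Ring A] (x y z x' y' z' : A) :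
    !![x, y; 0, z] + !![x', y'; 0, z'] = !![x + x', y + y'; 0, z + z'] := by
  ext i j
  fin_cases i <;> fin_cases j <;> simp

/-- The ring map which records the residue along a pair of points, together with the collapse of
this pair. -/
def confResidue (hq : q * q = 1) {u v : α} (huv : u ≠ v) :
    Conf q α →+* Matrix (Fin 2) (Fin 2) (Conf q α) :=
  confLift (fun a b => residueMatrix q (conf q (collapse u v a) (collapse u v b))
      (confRes q u v a b))
    (by
      intro a b c d
      rw [residueMatrix_mul hq, residueMatrix_mul hq, upper_smul, ← conf_comm, smul_add,
        smul_smul, smul_smul, ← mul_assoc, hq, one_mul, add_comm])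
    (by
      intro a b
      rw [residueMatrix_mul hq, conf_sq]
      rcases confRes_eq_zero_or q u v a b with h | h <;>
        ext i j <;> fin_cases i <;> fin_cases j <;> simp [h])
    (by
      intro a b
      unfold residueMatrix
      rw [upper_smul, confRes_swap hq huv a b, conf_swap (collapse u v a), smul_comm, mul_smul])
    (by
      intro a
      rw [confRes_self q huv]
      ext i j
      fin_cases i <;> fin_cases j <;> simp [residueMatrix])
    (by
      intro a b c
      -- A nonzero residue on one side of the triangle means that the ends of this side coincide
      -- after the collapse, so the other two sides agree up to orientation.
      have h1 : confRes q u v b c • conf q (collapse u v a) (collapse u v b) =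
          confRes q u v b c • conf q (collapse u v a) (collapse u v c) := by
        rcases confRes_eq_zero_or q u v b c with h | h <;> simp [h]
      have h2 : confRes q u v a b • conf q (collapse u v b) (collapse u v c) =
          confRes q u v a b • conf q (collapse u v a) (collapse u v c) := by
        rcases confRes_eq_zero_or q u v a b with h | h <;> simp [h]
      have h3 : confRes q u v a c • conf q (collapse u v b) (collapse u v c) =
          -q • confRes q u v a c • conf q (collapse u v a) (collapse u v b) := by
        rcases confRes_eq_zero_or q u v a c with h | h
        · simp [h]
        · rw [← h, conf_swap (collapse u v a) (collapse u v b), smul_comm]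
      rw [residueMatrix_mul hq, residueMatrix_mul hq, residueMatrix_mul hq, upper_smul, upper_add,
        ← conf_triangle, mul_smul, mul_smul, mul_smul, h1, h2, h3, smul_add, smul_smul q q, hq,
        one_smul]
      congr 4
      rw [neg_smul]
      abel)

theorem confResidue_conf (hq : q * q = 1) {u v : α} (huv : u ≠ v) (a b : α) :
    confResidue hq huv (conf q a b) =
      residueMatrix q (conf q (collapse u v a) (collapse u v b)) (confRes q u v a b) := by
  simp [confResidue]

end Configuration

/-! ### Walks and the collapse of two vertices. -/

section Walks

variable {α : Type*} {E : Type*}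

/-- The vertex where the traversal `y` of an edge starts; the edge `e` goes from `s e` to `t e`, and
it is traversed in this direction if `y.2` is `true`. -/
def stepSrc (s t : E → α) (y : E × Bool) : α := bif y.2 then s y.1 else t y.1

/-- The vertex where the traversal `y` of an edge arrives. -/
def stepTgt (s t : E → α) (y : E × Bool) : α := bif y.2 then t y.1 else s y.1

/-- The traversals in the list form a walk from `a` to `b`. -/
def Walk (s t : E → α) : α → List (E × Bool) → α → Prop
  | a, [], b => a = b
  | a, y :: w, b => stepSrc s t y = a ∧ Walk s t (stepTgt s t y) w b

theorem Walk.append {s t : E → α} {a b c : α} {w w' : List (E × Bool)} (h : Walk s t a w b)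
    (h' : Walk s t b w' c) : Walk s t a (w ++ w') c := by
  induction w generalizing a with
  | nil => cases h; exact h'
  | cons y w ih => exact ⟨h.1, ih h.2⟩

theorem stepSrc_comp {β : Type*} (f : α → β) (s t : E → α) (y : E × Bool) :
    stepSrc (f ∘ s) (f ∘ t) y = f (stepSrc s t y) := by
  obtain ⟨e, _ | _⟩ := y <;> rfl

theorem stepTgt_comp {β : Type*} (f : α → β) (s t : E → α) (y : E × Bool) :
    stepTgt (f ∘ s) (f ∘ t) y = f (stepTgt s t y) := by
  obtain ⟨e, _ | _⟩ := y <;> rfl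

/-- A walk after the collapse of `v` to `u` either comes from a walk, or passes through the
collapsed vertex. -/
theorem Walk.lift_or_split {s t : E → α} {u v : α} {w : List (E × Bool)} (hw : w ≠ []) {a b : α}
    (h : Walk (collapse u v ∘ s) (collapse u v ∘ t) a w b) :
    (∃ a' b', collapse u v a' = a ∧ collapse u v b' = b ∧ Walk s t a' w b') ∨
      ∃ w₁ w₂, w₁ ≠ [] ∧ w₂ ≠ [] ∧ w = w₁ ++ w₂ ∧
        Walk (collapse u v ∘ s) (collapse u v ∘ t) a w₁ u ∧
        Walk (collapse u v ∘ s) (collapse u v ∘ t) u w₂ b := by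
  induction w generalizing a with
  | nil => exact absurd rfl hw
  | cons y w ih =>
    obtain ⟨ha, hb⟩ := h
    rw [stepSrc_comp] at ha
    rcases eq_or_ne w [] with rfl | hne
    · have hb : stepTgt (collapse u v ∘ s) (collapse u v ∘ t) y = b := hb
      rw [stepTgt_comp] at hb
      exact Or.inl ⟨_, _, ha, hb, rfl, rfl⟩
    · rcases ih hne hb with ⟨a', b', ha', hb', hw'⟩ | ⟨w₁, w₂, h₁, h₂, rfl, hw₁, hw₂⟩
      · rw [stepTgt_comp] at ha'
        by_cases heq : a' = stepTgt s t y
        · exact Or.inl ⟨_, b', ha, hb', rfl, heq ▸ hw'⟩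
        · have hu : stepTgt (collapse u v ∘ s) (collapse u v ∘ t) y = u := by
            rw [stepTgt_comp]
            rcases collapse_eq ha' with h | h | h
            · exact absurd h heq
            · rw [h.2, collapse_right]
            · rw [h.2, collapse_left]
          exact Or.inr ⟨[y], w, by simp, hne, rfl, ⟨by rw [stepSrc_comp, ha], hu⟩,
            by rwa [hu] at hb⟩
      · exact Or.inr ⟨y :: w₁, w₂, by simp, h₂, rfl, ⟨by rw [stepSrc_comp, ha], hw₁⟩, hw₂⟩

end Walks

/-! ### Circuit ideals supported on a set of edges. -/

section CircuitIdeal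

variable {α : Type u} {E : Type v} {A : Type*} [Ring A] {q : ℤ}

/-- The element of the ring given by a traversal of an edge. -/
def stepGen (q : ℤ) (x : E → A) (y : E × Bool) : A := bif y.2 then x y.1 else -q • x y.1

theorem stepGen_comm {x : E → A} (hx : ∀ a b, x a * x b = q • (x b * x a)) (y z : E × Bool) :
    stepGen q x y * stepGen q x z = q • (stepGen q x z * stepGen q x y) := by
  obtain ⟨a, _ | _⟩ := y <;> obtain ⟨b, _ | _⟩ := z <;>
    simp only [stepGen, cond_true, cond_false, smul_mul_assoc, mul_smul_comm, hx a b,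
      smul_comm q (-q)]

theorem map_stepGen {B : Type*} [Ring B] (f : A →+* B) (x : E → A) (y : E × Bool) :
    f (stepGen q x y) = stepGen q (f ∘ x) y := by
  obtain ⟨a, _ | _⟩ := y <;> simp [stepGen]

/-- The subring generated by the elements which belong to the edges in `S`. -/
def edgeSubring (x : E → A) (S : Set E) : Subring A := Subring.closure (x '' S)

theorem mem_edgeSubring (x : E → A) {S : Set E} {e : E} (he : e ∈ S) : x e ∈ edgeSubring x S :=
  Subring.subset_closure ⟨e, he, rfl⟩

theorem edgeSubring_mono (x : E → A) {S T : Set E} (h : S ⊆ T) :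
    edgeSubring x S ≤ edgeSubring x T :=
  Subring.closure_mono (Set.image_mono h)

theorem stepGen_mem (x : E → A) {S : Set E} {y : E × Bool} (hy : y.1 ∈ S) :
    stepGen q x y ∈ edgeSubring x S := by
  obtain ⟨a, _ | _⟩ := y
  · exact zsmul_mem (mem_edgeSubring x hy) _
  · exact mem_edgeSubring x hy

theorem prod_stepGen_mem (x : E → A) {S : Set E} {w : List (E × Bool)} (hw : ∀ y ∈ w, y.1 ∈ S) :
    (w.map (stepGen q x)).prod ∈ edgeSubring x S := by
  refine Subring.list_prod_mem _ fun z hz => ?_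
  obtain ⟨y, hy, rfl⟩ := List.mem_map.1 hz
  exact stepGen_mem x (hw y hy)

/-- The ideal of `edgeSubring x S` generated by the Arnold classes of the circuits with edges in
`S`. -/
def circuitIdeal (q : ℤ) (s t : E → α) (x : E → A) (S : Set E) : AddSubgroup A :=
  AddSubgroup.closure {z | ∃ a w, w ≠ [] ∧ Walk s t a w a ∧ (∀ y ∈ w, y.1 ∈ S) ∧
    ∃ m ∈ edgeSubring x S, z = boundary q (w.map (stepGen q x)) * m}

variable {s t : E → α} {x : E → A} {S : Set E}

theorem boundary_mul_mem_circuitIdeal {a : α} {w : List (E × Bool)} (hne : w ≠ [])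
    (hw : Walk s t a w a) (hS : ∀ y ∈ w, y.1 ∈ S) {m : A} (hm : m ∈ edgeSubring x S) :
    boundary q (w.map (stepGen q x)) * m ∈ circuitIdeal q s t x S :=
  AddSubgroup.subset_closure ⟨a, w, hne, hw, hS, m, hm, rfl⟩

theorem mul_mem_circuitIdeal {z m : A} (hz : z ∈ circuitIdeal q s t x S)
    (hm : m ∈ edgeSubring x S) : z * m ∈ circuitIdeal q s t x S := by
  induction hz using AddSubgroup.closure_induction with
  | mem z h =>
    obtain ⟨a, w, hne, hw, hS, m', hm', rfl⟩ := h
    rw [mul_assoc]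
    exact boundary_mul_mem_circuitIdeal hne hw hS (mul_mem hm' hm)
  | zero => rw [zero_mul]; exact zero_mem _
  | add y z _ _ hy hz => rw [add_mul]; exact add_mem hy hz
  | neg z _ hz => rw [neg_mul]; exact neg_mem hz

theorem circuitIdeal_mono {T : Set E} (h : S ⊆ T) :
    circuitIdeal q s t x S ≤ circuitIdeal q s t x T := by
  refine AddSubgroup.closure_mono ?_
  rintro _ ⟨a, w, hne, hw, hS, m, hm, rfl⟩
  exact ⟨a, w, hne, hw, fun y hy => h (hS y hy), m, edgeSubring_mono x h hm, rfl⟩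

/-- A circuit of length one has the empty product `1` as its boundary. -/
theorem mem_circuitIdeal_of_loop {e : E} (he : e ∈ S) (hst : s e = t e) {z : A}
    (hz : z ∈ edgeSubring x S) : z ∈ circuitIdeal q s t x S := by
  have h := boundary_mul_mem_circuitIdeal (q := q) (s := s) (t := t) (x := x) (S := S) (a := t e)
    (w := [(e, true)]) (by simp) ⟨hst, rfl⟩ (by simpa using he) hz
  simpa using h

/-- An element supported away from the edge `f` moves past `f`. -/
theorem exists_mul_gen_eq (hx : ∀ a b, x a * x b = q • (x b * x a)) (f : E) {y : A}
    (hy : y ∈ edgeSubring x S) : ∃ y' ∈ edgeSubring x S, y * x f = x f * y' := by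
  induction hy using Subring.closure_induction with
  | mem y h =>
    obtain ⟨e, he, rfl⟩ := h
    exact ⟨q • x e, zsmul_mem (mem_edgeSubring x he) _, by rw [hx, mul_smul_comm]⟩
  | zero => exact ⟨0, zero_mem _, by simp⟩
  | one => exact ⟨1, one_mem _, by simp⟩
  | add y z _ _ hy hz =>
    obtain ⟨y', hy', ey⟩ := hy
    obtain ⟨z', hz', ez⟩ := hz
    exact ⟨y' + z', add_mem hy' hz', by rw [add_mul, mul_add, ey, ez]⟩
  | neg y _ hy =>
    obtain ⟨y', hy', ey⟩ := hy
    exact ⟨-y', neg_mem hy', by rw [neg_mul, mul_neg, ey]⟩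
  | mul y z _ _ hy hz =>
    obtain ⟨y', hy', ey⟩ := hy
    obtain ⟨z', hz', ez⟩ := hz
    exact ⟨y' * z', mul_mem hy' hz', by rw [mul_assoc, ez, ← mul_assoc, ey, mul_assoc]⟩

/-- Every occurrence of `x f` can be moved to the front, and two occurrences give zero since `x f`
squares to zero. -/
theorem exists_eq_add_gen_mul (hx : ∀ a b, x a * x b = q • (x b * x a))
    (hsq : ∀ a, x a * x a = 0) {f : E} {y : A} (hy : y ∈ edgeSubring x (insert f S)) :
    ∃ a ∈ edgeSubring x S, ∃ b ∈ edgeSubring x S, y = a + x f * b := by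
  induction hy using Subring.closure_induction with
  | mem y h =>
    obtain ⟨e, rfl | he, rfl⟩ := h
    · exact ⟨0, zero_mem _, 1, one_mem _, by simp⟩
    · exact ⟨x e, mem_edgeSubring x he, 0, zero_mem _, by simp⟩
  | zero => exact ⟨0, zero_mem _, 0, zero_mem _, by simp⟩
  | one => exact ⟨1, one_mem _, 0, zero_mem _, by simp⟩
  | add y z _ _ hy hz =>
    obtain ⟨a, ha, b, hb, rfl⟩ := hy
    obtain ⟨c, hc, d, hd, rfl⟩ := hz
    exact ⟨a + c, add_mem ha hc, b + d, add_mem hb hd, by rw [mul_add]; abel⟩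
  | neg y _ hy =>
    obtain ⟨a, ha, b, hb, rfl⟩ := hy
    exact ⟨-a, neg_mem ha, -b, neg_mem hb, by rw [mul_neg]; abel⟩
  | mul y z _ _ hy hz =>
    obtain ⟨a, ha, b, hb, rfl⟩ := hy
    obtain ⟨c, hc, d, hd, rfl⟩ := hz
    obtain ⟨a', ha', ea⟩ := exists_mul_gen_eq hx f ha
    obtain ⟨b', hb', eb⟩ := exists_mul_gen_eq hx f hb
    refine ⟨a * c, mul_mem ha hc, b * c + a' * d, add_mem (mul_mem hb hc) (mul_mem ha' hd), ?_⟩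
    have h0 : x f * b * (x f * d) = 0 := by
      rw [← mul_assoc, mul_assoc (x f) b, eb, ← mul_assoc, hsq, zero_mul, zero_mul]
    rw [add_mul, mul_add, mul_add, h0, add_zero, ← mul_assoc a, ea, mul_add]
    simp only [mul_assoc]
    abel

/-! ### Lifting circuits from the contraction of an edge. -/

/-- Modulo the circuits, `x f * z` is supported away from the edge `f`. -/
def Liftable (q : ℤ) (s t : E → α) (x : E → A) (S : Set E) (f : E) (z : A) : Prop :=
  ∃ y ∈ edgeSubring x S, y + x f * z ∈ circuitIdeal q s t x (insert f S)

theorem Liftable.add {f : E} {z z' : A} (h : Liftable q s t x S f z)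
    (h' : Liftable q s t x S f z') : Liftable q s t x S f (z + z') := by
  obtain ⟨y, hy, hz⟩ := h
  obtain ⟨y', hy', hz'⟩ := h'
  refine ⟨y + y', add_mem hy hy', ?_⟩
  rw [mul_add, add_add_add_comm]
  exact add_mem hz hz'

theorem Liftable.neg {f : E} {z : A} (h : Liftable q s t x S f z) :
    Liftable q s t x S f (-z) := by
  obtain ⟨y, hy, hz⟩ := h
  refine ⟨-y, neg_mem hy, ?_⟩
  rw [mul_neg, ← neg_add]
  exact neg_mem hz

theorem Liftable.smul {f : E} {z : A} (n : ℤ) (h : Liftable q s t x S f z) :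
    Liftable q s t x S f (n • z) := by
  obtain ⟨y, hy, hz⟩ := h
  refine ⟨n • y, zsmul_mem hy n, ?_⟩
  rw [mul_smul_comm, ← smul_add]
  exact zsmul_mem hz n

theorem Liftable.mul {f : E} {z m : A} (h : Liftable q s t x S f z) (hm : m ∈ edgeSubring x S) :
    Liftable q s t x S f (z * m) := by
  obtain ⟨y, hy, hz⟩ := h
  refine ⟨y * m, mul_mem hy hm, ?_⟩
  rw [← mul_assoc, ← add_mul]
  exact mul_mem_circuitIdeal hz (edgeSubring_mono x (Set.subset_insert f S) hm)

theorem liftable_boundary_of_circuit (hq : q * q = 1)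
    (hx : ∀ a b, x a * x b = q • (x b * x a)) {f : E} {a : α} {w : List (E × Bool)}
    (hne : w ≠ []) (hS : ∀ y ∈ w, y.1 ∈ S) (hw : Walk s t a w a) :
    Liftable q s t x S f (boundary q (w.map (stepGen q x))) := by
  refine ⟨0, zero_mem _, ?_⟩
  rw [zero_add, mul_boundary_of_comm hq]
  · exact zsmul_mem (boundary_mul_mem_circuitIdeal hne hw (fun y hy => Or.inr (hS y hy))
      (mem_edgeSubring x (Set.mem_insert f S))) _
  · intro z hz
    obtain ⟨y, -, rfl⟩ := List.mem_map.1 hz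
    exact stepGen_comm hx (f, true) y

/-- The edge `f` closes the walk to a circuit. Up to sign, the boundary of this circuit is `x f`
times the boundary of `w` plus a multiple of the product along `w`, which avoids `f`. -/
theorem liftable_boundary_of_walk (hq : q * q = 1) {f : E} {b : Bool} {w : List (E × Bool)}
    (hS : ∀ y ∈ w, y.1 ∈ S) (hw : Walk s t (stepTgt s t (f, b)) w (stepSrc s t (f, b))) :
    Liftable q s t x S f (boundary q (w.map (stepGen q x))) := by
  have h := boundary_mul_mem_circuitIdeal (q := q) (x := x) (S := insert f S) (w := (f, b) :: w)
    (by simp) ⟨rfl, hw⟩ (by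
      intro y hy
      rcases List.mem_cons.1 hy with rfl | hy
      · exact Or.inl rfl
      · exact Or.inr (hS y hy)) (one_mem _)
  rw [mul_one, List.map_cons, boundary_cons] at h
  cases b with
  | true =>
    refine ⟨q • (w.map (stepGen q x)).prod, zsmul_mem (prod_stepGen_mem x hS) _, ?_⟩
    have h' := zsmul_mem h q
    rwa [smul_add, smul_smul, hq, one_smul] at h'
  | false =>
    -- Traversed backwards, `f` contributes `-q • x f`, and `q * (-q) = -1`.
    refine ⟨-(w.map (stepGen q x)).prod, neg_mem (prod_stepGen_mem x hS), ?_⟩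
    have h' := neg_mem h
    have e : stepGen q x (f, false) = -q • x f := rfl
    rwa [e, smul_mul_assoc, smul_smul, mul_neg, hq, neg_smul, one_smul, neg_add, neg_neg] at h'

theorem liftable_boundary_of_collapse (hq : q * q = 1)
    (hx : ∀ a b, x a * x b = q • (x b * x a)) {f : E} {a b : α} {w : List (E × Bool)}
    (hne : w ≠ []) (hS : ∀ y ∈ w, y.1 ∈ S) (hw : Walk s t a w b)
    (hab : collapse (s f) (t f) a = collapse (s f) (t f) b) :
    Liftable q s t x S f (boundary q (w.map (stepGen q x))) := by
  rcases collapse_eq hab with rfl | ⟨rfl, rfl⟩ | ⟨rfl, rfl⟩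
  · exact liftable_boundary_of_circuit hq hx hne hS hw
  · exact liftable_boundary_of_walk hq (b := false) hS hw
  · exact liftable_boundary_of_walk hq (b := true) hS hw

theorem liftable_boundary_append (hq : q * q = 1)
    (hx : ∀ a b, x a * x b = q • (x b * x a)) {f : E} {w w' : List (E × Bool)}
    (hS : ∀ y ∈ w, y.1 ∈ S) (hS' : ∀ y ∈ w', y.1 ∈ S)
    (h : Liftable q s t x S f (boundary q (w.map (stepGen q x))))
    (h' : Liftable q s t x S f (boundary q (w'.map (stepGen q x)))) :
    Liftable q s t x S f (boundary q ((w ++ w').map (stepGen q x))) := by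
  rw [List.map_append, boundary_append_of_comm hq]
  · exact (h.mul (prod_stepGen_mem x hS')).add ((h'.mul (prod_stepGen_mem x hS)).smul _)
  · intro y hy z hz
    obtain ⟨y, -, rfl⟩ := List.mem_map.1 hy
    obtain ⟨z, -, rfl⟩ := List.mem_map.1 hz
    exact stepGen_comm hx y z

/-- A circuit based at the collapsed vertex that does not lift to a walk splits there into two
shorter circuits with the same base point. -/
theorem liftable_boundary_of_based (hq : q * q = 1)
    (hx : ∀ a b, x a * x b = q • (x b * x a)) {f : E} {w : List (E × Bool)} (hne : w ≠ [])
    (hS : ∀ y ∈ w, y.1 ∈ S)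
    (hw : Walk (collapse (s f) (t f) ∘ s) (collapse (s f) (t f) ∘ t) (s f) w (s f)) :
    Liftable q s t x S f (boundary q (w.map (stepGen q x))) := by
  induction hn : w.length using Nat.strong_induction_on generalizing w with
  | _ n ih =>
    subst hn
    rcases hw.lift_or_split hne with ⟨a, b, ha, hb, hw'⟩ | ⟨w₁, w₂, h₁, h₂, rfl, hw₁, hw₂⟩
    · exact liftable_boundary_of_collapse hq hx hne hS hw' (ha.trans hb.symm)
    · have l₁ := List.length_pos_iff.2 h₁
      have l₂ := List.length_pos_iff.2 h₂
      have hS₁ : ∀ y ∈ w₁, y.1 ∈ S := fun y hy => hS y (by simp [hy])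
      have hS₂ : ∀ y ∈ w₂, y.1 ∈ S := fun y hy => hS y (by simp [hy])
      refine liftable_boundary_append hq hx hS₁ hS₂ (ih _ ?_ h₁ hS₁ hw₁ rfl)
        (ih _ ?_ h₂ hS₂ hw₂ rfl) <;>
      · rw [List.length_append]
        omega

/-- The circuits after the contraction of the edge `f` lift to circuits. -/
theorem liftable_of_mem_circuitIdeal (hq : q * q = 1)
    (hx : ∀ a b, x a * x b = q • (x b * x a)) {f : E} {z : A}
    (hz : z ∈ circuitIdeal q (collapse (s f) (t f) ∘ s) (collapse (s f) (t f) ∘ t) x S) :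
    Liftable q s t x S f z := by
  induction hz using AddSubgroup.closure_induction with
  | mem z h =>
    obtain ⟨a, w, hne, hw, hS, m, hm, rfl⟩ := h
    refine Liftable.mul ?_ hm
    rcases hw.lift_or_split hne with ⟨a, b, ha, hb, hw'⟩ | ⟨w₁, w₂, h₁, h₂, rfl, hw₁, hw₂⟩
    · exact liftable_boundary_of_collapse hq hx hne hS hw' (ha.trans hb.symm)
    -- The rotated circuit `w₂ ++ w₁` is based at the collapsed vertex.
    · rw [List.map_append, boundary_append_comm hq, ← List.map_append]
      · refine (liftable_boundary_of_based hq hx (by simp [h₁]) ?_ (hw₂.append hw₁)).smul _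
        intro y hy
        exact hS y (by simpa [or_comm] using hy)
      · intro y hy z hz
        obtain ⟨y, -, rfl⟩ := List.mem_map.1 hy
        obtain ⟨z, -, rfl⟩ := List.mem_map.1 hz
        exact stepGen_comm hx y z
  | zero => exact ⟨0, zero_mem _, by simp⟩
  | add y z _ _ hy hz => exact hy.add hz
  | neg z _ hz => exact hz.neg

/-! ### The kernel of the map to the Arnold ring. -/

theorem stepGen_conf (y : E × Bool) :
    stepGen q (fun e => conf q (s e) (t e)) y = conf q (stepSrc s t y) (stepTgt s t y) := by
  obtain ⟨e, _ | _⟩ := y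
  · exact (conf_swap (s e) (t e)).symm
  · rfl

/-- Induction on the walk: the three-term relation for `a`, the end of the first step, and `b` pulls
`conf q a b` out to the left. -/
theorem Walk.prod_conf {w : List (E × Bool)} (hne : w ≠ []) {a b : α}
    (hw : Walk s t a w b) :
    (w.map (stepGen q fun e => conf q (s e) (t e))).prod =
      conf q a b * boundary q (w.map (stepGen q fun e => conf q (s e) (t e))) := by
  induction w generalizing a with
  | nil => exact absurd rfl hne
  | cons y w ih =>
    obtain ⟨rfl, hw⟩ := hw
    rw [List.map_cons, List.prod_cons, boundary_cons, stepGen_conf]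
    rcases eq_or_ne w [] with rfl | hne'
    · have hw : stepTgt s t y = b := hw
      simp [hw]
    · rw [mul_add, ih hne' hw, ← mul_assoc, conf_triangle, mul_smul_comm, ← mul_assoc, add_mul,
        smul_mul_assoc, ← mul_assoc]

/-- By `Walk.prod_conf` for the walk after the first step, the two terms of the boundary differ only
by the reversal of that step and cancel by `conf_swap`. Loops must be excluded, since their boundary
is `1`. -/
theorem Walk.boundary_conf {w : List (E × Bool)} (hne : w ≠ []) {a : α}
    (hw : Walk s t a w a) (hl : ∀ y ∈ w, s y.1 ≠ t y.1) :
    boundary q (w.map (stepGen q fun e => conf q (s e) (t e))) = 0 := by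
  cases w with
  | nil => exact absurd rfl hne
  | cons y w =>
    obtain ⟨rfl, hw⟩ := hw
    rcases eq_or_ne w [] with rfl | hne'
    · have hw : stepTgt s t y = stepSrc s t y := hw
      have := hl y (by simp)
      obtain ⟨e, _ | _⟩ := y
      · exact absurd hw this
      · exact absurd hw.symm this
    · rw [List.map_cons, boundary_cons, hw.prod_conf hne', stepGen_conf,
        conf_swap (stepSrc s t y), neg_smul, neg_mul, smul_mul_assoc, neg_add_cancel]

theorem map_eq_zero_of_mem_circuitIdeal (F : A →+* Conf q α)
    (hF : ∀ e, F (x e) = conf q (s e) (t e)) (hl : ∀ e ∈ S, s e ≠ t e) {z : A}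
    (hz : z ∈ circuitIdeal q s t x S) : F z = 0 := by
  induction hz using AddSubgroup.closure_induction with
  | mem z h =>
    obtain ⟨a, w, hne, hw, hS, m, hm, rfl⟩ := h
    have e : F ∘ stepGen q x = stepGen q fun e => conf q (s e) (t e) := by
      funext y
      rw [Function.comp_apply, map_stepGen, show F ∘ x = fun e => conf q (s e) (t e) from funext hF]
    rw [map_mul, map_boundary, List.map_map, e, hw.boundary_conf hne fun y hy => hl _ (hS y hy),
      zero_mul]
  | zero => exact map_zero F
  | add y z _ _ hy hz => rw [map_add, hy, hz, add_zero]
  | neg z _ hz => rw [map_neg, hz, neg_zero]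

/-- No edge of `S` joins `u` and `v`, so all generators have residue zero and diagonal matrices; the
lower diagonal entry is the map for the contracted graph. -/
theorem confResidue_of_mem_edgeSubring (hq : q * q = 1) {u v : α} (huv : u ≠ v)
    (F F' : A →+* Conf q α) (hF : ∀ e, F (x e) = conf q (s e) (t e))
    (hF' : ∀ e, F' (x e) = conf q (collapse u v (s e)) (collapse u v (t e)))
    (hl : ∀ e ∈ S, collapse u v (s e) ≠ collapse u v (t e)) {y : A}
    (hy : y ∈ edgeSubring x S) :
    confResidue hq huv (F y) 0 1 = 0 ∧ confResidue hq huv (F y) 1 1 = F' y ∧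
      confResidue hq huv (F y) 1 0 = 0 := by
  induction hy using Subring.closure_induction with
  | mem y h =>
    obtain ⟨e, he, rfl⟩ := h
    have h0 := (confRes_eq_zero_or q u v (s e) (t e)).resolve_right (hl e he)
    rw [hF, confResidue_conf, hF', h0]
    simp [residueMatrix]
  | zero => simp
  | one => simp
  | add y z _ _ hy hz => simp [hy, hz]
  | neg y _ hy => simp [hy]
  | mul y z _ _ hy hz => simp [Matrix.mul_apply, Fin.sum_univ_two, hy, hz]

theorem confAug_eq_zero {A : Type*} [Ring A] (F : A →+* Conf q α) {n : ℤ} (h : F n = 0) :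
    n = 0 := by
  have := congrArg (confAug q α) h
  simpa using this

/-- The kernel of the map to the Arnold ring of configurations is generated by the circuits. -/
theorem mem_circuitIdeal_of_map_eq_zero (hq : q * q = 1)
    (hx : ∀ a b, x a * x b = q • (x b * x a)) (hsq : ∀ a, x a * x a = 0)
    (F : (E → α) → (E → α) → A →+* Conf q α)
    (hF : ∀ s t e, F s t (x e) = conf q (s e) (t e)) (hfin : S.Finite) (s t : E → α) {y : A}
    (hy : y ∈ edgeSubring x S) (h : F s t y = 0) : y ∈ circuitIdeal q s t x S := by
  induction S, hfin using Set.Finite.induction_on generalizing s t y with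
  | empty =>
    rw [edgeSubring, Set.image_empty, Subring.closure_empty, Subring.mem_bot] at hy
    obtain ⟨n, rfl⟩ := hy
    rw [confAug_eq_zero (F s t) h, Int.cast_zero]
    exact zero_mem _
  | @insert f S hf _ ih =>
    by_cases hl : ∀ e ∈ insert f S, s e ≠ t e
    · obtain ⟨a, ha, b, hb, rfl⟩ := exists_eq_add_gen_mul hx hsq hy
      have hfst : s f ≠ t f := hl f (Set.mem_insert f S)
      -- Contraction: the matrix of `x f` has `1` in the corner and zeros elsewhere, so the corner
      -- entry of the image of `a + x f * b` is the image of `b` in the contracted graph. If another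
      -- edge becomes a loop, the ideal is everything.
      have hb' : b ∈ circuitIdeal q (collapse (s f) (t f) ∘ s) (collapse (s f) (t f) ∘ t) x S := by
        by_cases hl' : ∀ e ∈ S, collapse (s f) (t f) (s e) ≠ collapse (s f) (t f) (t e)
        · refine ih _ _ hb ?_
          have hres := @confResidue_of_mem_edgeSubring _ _ _ _ _ s t x S hq _ _ hfst (F s t) _ (hF s t)
            (hF (collapse (s f) (t f) ∘ s) (collapse (s f) (t f) ∘ t)) hl'
          have h' := congrFun (congrFun (congrArg (confResidue hq hfst) h) 0) 1
          rw [map_add, map_add, map_mul, map_mul, Matrix.add_apply, (hres ha).1, zero_add,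
            Matrix.mul_apply, Fin.sum_univ_two, (hres hb).1, mul_zero, zero_add, (hres hb).2.1,
            hF, confResidue_conf] at h'
          simpa [residueMatrix, confRes] using h'
        · push Not at hl'
          obtain ⟨e, he, hst⟩ := hl'
          exact mem_circuitIdeal_of_loop he hst hb
      obtain ⟨c, hc, hcb⟩ := liftable_of_mem_circuitIdeal hq hx hb'
      have h0 := map_eq_zero_of_mem_circuitIdeal (F s t) (hF s t) hl hcb
      -- Deletion: `c + x f * b` is in the circuit ideal, hence in the kernel, and so is its
      -- difference from `a + x f * b`.
      have hac : a - c ∈ circuitIdeal q s t x S := by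
        refine ih s t (sub_mem ha hc) ?_
        rw [← add_sub_add_right_eq_sub a c (x f * b), map_sub, h, h0, sub_zero]
      rw [← sub_add_cancel a c, add_assoc]
      exact add_mem (circuitIdeal_mono (Set.subset_insert f S) hac) hcb
    · push Not at hl
      obtain ⟨e, he, hst⟩ := hl
      exact mem_circuitIdeal_of_loop he hst hy

end CircuitIdeal

/-! ### Application to the rings of graphs. -/

section Graphs

variable {α : Type u} {β : Type v}

/-- The sign `(-1)^(r+1)` of the graded commutativity of `Λ^r`. -/
def gradedSign (r : ℕ) : ℤ := (-1) ^ (r + 1)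

theorem gradedSign_mul_self (r : ℕ) : gradedSign r * gradedSign r = 1 := by
  rw [gradedSign, ← mul_pow, neg_one_mul, neg_neg, one_pow]

theorem gradedSign_of_odd {r : ℕ} (h : Odd r) : gradedSign r = 1 := h.add_one.neg_one_pow

theorem gradedSign_of_not_odd {r : ℕ} (h : ¬Odd r) : gradedSign r = -1 :=
  (Nat.not_odd_iff_even.1 h).add_one.neg_one_pow

theorem gen_mul_gen (r : ℕ) {E : Type v} (a b : E) :
    gen r a * gen r b = gradedSign r • (gen r b * gen r a) := by
  rw [gen_comm, zsmul_eq_mul, gradedSign]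
  push_cast
  rfl

/-- A ring map out of `Λ^r`, from the images of the generators. -/
def lambdaLift (r : ℕ) {E : Type v} {A : Type*} [Ring A] (g : E → A)
    (comm : ∀ a b, g a * g b = gradedSign r • (g b * g a)) (sq : ∀ a, g a * g a = 0) :
    Lambda r E →+* A :=
  RingQuot.lift ⟨(FreeAlgebra.lift ℤ g).toRingHom, by
    intro x y h
    cases h with
    | comm a b => simpa [gradedSign] using comm a b
    | sq a => simpa using sq a⟩

@[simp] theorem lambdaLift_gen (r : ℕ) {E : Type v} {A : Type*} [Ring A] (g : E → A) (comm sq)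
    (a : E) : lambdaLift r g comm sq (gen r a) = g a := by
  refine (RingQuot.lift_mkRingHom_apply _ _ _).trans ?_
  simp

theorem lambda_closure_gen (r : ℕ) (E : Type v) :
    Subring.closure (Set.range (gen r : E → Lambda r E)) = ⊤ := by
  refine top_unique fun x _ => ?_
  obtain ⟨x, rfl⟩ := RingQuot.mkRingHom_surjective _ x
  induction x using FreeAlgebra.induction with
  | grade0 n =>
    rw [eq_intCast (algebraMap ℤ (FreeAlgebra ℤ E)) n, map_intCast]
    exact intCast_mem _ n
  | grade1 a => exact Subring.subset_closure ⟨a, rfl⟩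
  | mul x y hx hy => rw [map_mul]; exact mul_mem (hx trivial) (hy trivial)
  | add x y hx hy => rw [map_add]; exact add_mem (hx trivial) (hy trivial)

theorem lambdaHom_ext {r : ℕ} {E : Type v} {A : Type*} [Ring A] {f g : Lambda r E →+* A}
    (h : ∀ a, f (gen r a) = g (gen r a)) : f = g := by
  refine RingHom.eq_of_eqOn_set_dense (lambda_closure_gen r E) ?_
  rintro _ ⟨a, rfl⟩
  exact h a

/-- The map from `Λ^r` to the Arnold ring of the configurations of the vertices. -/
def toConf (r : ℕ) {E : Type v} (s t : E → α) : Lambda r E →+* Conf (gradedSign r) α :=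
  lambdaLift r (fun e => conf (gradedSign r) (s e) (t e)) (fun _ _ => conf_comm _ _ _ _)
    fun _ => conf_sq _ _

theorem toConf_gen (r : ℕ) {E : Type v} (s t : E → α) (e : E) :
    toConf r s t (gen r e) = conf (gradedSign r) (s e) (t e) := by
  simp [toConf]

theorem exists_finite_mem_edgeSubring (r : ℕ) {E : Type v} (x : Lambda r E) :
    ∃ S : Set E, S.Finite ∧ x ∈ edgeSubring (gen r) S := by
  have hx : x ∈ Subring.closure (Set.range (gen r : E → Lambda r E)) := by
    rw [lambda_closure_gen]; trivial
  induction hx using Subring.closure_induction with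
  | mem x h =>
    obtain ⟨e, rfl⟩ := h
    exact ⟨{e}, Set.finite_singleton e, mem_edgeSubring _ rfl⟩
  | zero => exact ⟨∅, Set.finite_empty, zero_mem _⟩
  | one => exact ⟨∅, Set.finite_empty, one_mem _⟩
  | add y z _ _ hy hz =>
    obtain ⟨S, hS, hy⟩ := hy
    obtain ⟨T, hT, hz⟩ := hz
    exact ⟨S ∪ T, hS.union hT, add_mem (edgeSubring_mono _ Set.subset_union_left hy)
      (edgeSubring_mono _ Set.subset_union_right hz)⟩
  | neg y _ hy =>
    obtain ⟨S, hS, hy⟩ := hy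
    exact ⟨S, hS, neg_mem hy⟩
  | mul y z _ _ hy hz =>
    obtain ⟨S, hS, hy⟩ := hy
    obtain ⟨T, hT, hz⟩ := hz
    exact ⟨S ∪ T, hS.union hT, mul_mem (edgeSubring_mono _ Set.subset_union_left hy)
      (edgeSubring_mono _ Set.subset_union_right hz)⟩

variable {G : Graph α β}

open Classical in
/-- A step, as an edge with a direction. -/
def Step.dir (O : Orientation G) (s : Step G) : E(G) × Bool :=
  (s.edge, decide (O.tail s.edge = s.src))

theorem Step.ends_dir (O : Orientation G) (s : Step G) :
    stepSrc O.tail O.head (s.dir O) = s.src ∧ stepTgt O.tail O.head (s.dir O) = s.tgt := by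
  have h := (O.isLink s.edge).eq_and_eq_or_eq_and_eq s.isLink
  by_cases hs : O.tail s.edge = s.src
  · simp only [stepSrc, stepTgt, dir, hs, decide_true, cond_true, true_and]
    rcases h with h | h
    · exact h.2
    · rw [h.2, ← hs, h.1]
  · simp only [stepSrc, stepTgt, dir, hs, decide_false, cond_false]
    rcases h with h | h
    · exact absurd h.1 hs
    · exact ⟨h.2, h.1⟩

/-- An edge with a direction, as a step. -/
def dirStep (O : Orientation G) (y : E(G) × Bool) : Step G where
  src := stepSrc O.tail O.head y
  edge := y.1
  tgt := stepTgt O.tail O.head y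
  isLink := by
    obtain ⟨e, _ | _⟩ := y
    · exact (O.isLink e).symm
    · exact O.isLink e

theorem walk_of_isChain (O : Orientation G) {s : Step G} {w : List (Step G)}
    (h : (s :: w).IsChain fun s t => s.tgt = t.src) :
    Walk O.tail O.head s.src ((s :: w).map (Step.dir O))
      ((s :: w).getLast (by simp)).tgt := by
  induction w generalizing s with
  | nil => exact s.ends_dir O
  | cons s' w ih =>
    rw [List.isChain_cons_cons] at h
    refine ⟨(s.ends_dir O).1, ?_⟩
    rw [(s.ends_dir O).2, h.1]
    exact ih h.2

theorem IsCircuit.walk (O : Orientation G) {w : List (Step G)} (hw : IsCircuit w) :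
    w ≠ [] ∧ ∃ a, Walk O.tail O.head a (w.map (Step.dir O)) a := by
  obtain ⟨hc, hne, hcl⟩ := hw
  refine ⟨hne, ?_⟩
  cases w with
  | nil => exact absurd rfl hne
  | cons s w =>
    have := walk_of_isChain O hc
    rw [hcl] at this
    exact ⟨_, this⟩

theorem Walk.isChain (O : Orientation G) {a b : α} {y : E(G) × Bool} {w : List (E(G) × Bool)}
    (h : Walk O.tail O.head a (y :: w) b) :
    ((y :: w).map (dirStep O)).IsChain (fun s t => s.tgt = t.src) ∧ (dirStep O y).src = a ∧
      (((y :: w).map (dirStep O)).getLast (by simp)).tgt = b := by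
  induction w generalizing a y with
  | nil => exact ⟨by simp, h.1, h.2⟩
  | cons z w ih =>
    obtain ⟨h1, h2, h3⟩ := ih h.2
    refine ⟨?_, h.1, ?_⟩
    · rw [List.map_cons, List.map_cons, List.isChain_cons_cons]
      exact ⟨h2.symm, h1⟩
    · simpa using h3

theorem Walk.isCircuit (O : Orientation G) {a : α} {w : List (E(G) × Bool)} (hne : w ≠ [])
    (h : Walk O.tail O.head a w a) : IsCircuit (w.map (dirStep O)) := by
  cases w with
  | nil => exact absurd rfl hne
  | cons y w =>
    obtain ⟨h1, h2, h3⟩ := h.isChain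
    exact ⟨h1, by simp, h3.trans h2.symm⟩

/-- A signed sum over the omissions of one factor from a product is, up to a sign, a boundary. -/
theorem exists_sum_eq_boundary {X A : Type*} [Ring A] {q η : ℤ} (c : ℕ → X → ℤ) (g γ : X → A)
    (ε : X → ℤ) (hε : ∀ x, ε x * ε x = 1) (hc : ∀ i x, c (i + 1) x = q * c i x)
    (hcε : ∀ x, c 1 x = η * ε x) (hg : ∀ x, g x = ε x • γ x) (w : List X) :
    ∃ k : ℤ, k * k = 1 ∧ (w.map g).prod = k • (w.map γ).prod ∧
      ∑ i : Fin w.length, c (i + 1) w[i] • ((w.eraseIdx i).map g).prod =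
        (η * k) • boundary q (w.map γ) := by
  induction w with
  | nil => exact ⟨1, by simp, by simp, by simp⟩
  | cons x w ih =>
    obtain ⟨k, hk, hp, ha⟩ := ih
    -- The sign `k` is the product of all `ε`: the omitted factor contributes its sign through `c`,
    -- the others through `g`, so every summand carries the same total sign.
    refine ⟨ε x * k, by rw [mul_mul_mul_comm, hε, hk, one_mul], ?_, ?_⟩
    · rw [List.map_cons, List.prod_cons, List.map_cons, List.prod_cons, hp, hg, smul_mul_assoc,
        mul_smul_comm, smul_smul]
    · have hsum : ∑ i : Fin w.length, c (i + 1 + 1) w[i] • (g x * ((w.eraseIdx i).map g).prod) =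
          q • (g x * ((η * k) • boundary q (w.map γ))) := by
        rw [← ha, Finset.mul_sum, Finset.smul_sum]
        refine Finset.sum_congr rfl fun i _ => ?_
        rw [hc, mul_smul_comm, smul_smul]
      refine (Fin.sum_univ_succ _).trans ?_
      refine (congrArg₂ (· + ·) ?_ hsum).trans (b := (η * ε x) • k • (w.map γ).prod + _) ?_
      · rw [← hp, ← hcε]
        rfl
      · rw [List.map_cons, boundary_cons, hg, smul_add, smul_mul_assoc, mul_smul_comm, smul_smul,
          smul_smul, smul_smul, smul_smul]
        congr 2 <;> ring

theorem exists_arnoldClass_eq (r : ℕ) (o : Odd r → Orientation G) (O : Orientation G)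
    (hO : ∀ h, o h = O) (w : List (Step G)) :
    ∃ k : ℤ, k * k = 1 ∧ arnoldClass r o w = k • boundary (gradedSign r)
      ((w.map (Step.dir O)).map (stepGen (gradedSign r) (gen r))) := by
  classical
  rw [List.map_map]
  by_cases hr : Odd r
  · obtain ⟨k, hk, -, h⟩ := exists_sum_eq_boundary (q := gradedSign r) (η := 1) (arnoldSign r o)
      (fun s => gen r s.edge) (stepGen (gradedSign r) (gen r) ∘ Step.dir O)
      (fun s => if O.tail s.edge = s.src then 1 else -1)
      (fun s => by split_ifs <;> simp) (fun i s => by simp [arnoldSign, hr, gradedSign_of_odd hr])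
      (fun s => by simp [arnoldSign, hr, hO])
      (fun s => by
        by_cases h : O.tail s.edge = s.src <;>
          simp [stepGen, Step.dir, h, gradedSign_of_odd hr]) w
    rw [one_mul] at h
    exact ⟨k, hk, h⟩
  -- For even `r`, reversing an edge has sign `-q = 1`, so the chosen orientation plays no role; `η
  -- = -1` because the positions in the Arnold class start at `1`.
  · obtain ⟨k, hk, -, h⟩ := exists_sum_eq_boundary (q := gradedSign r) (η := -1) (arnoldSign r o)
      (fun s => gen r s.edge) (stepGen (gradedSign r) (gen r) ∘ Step.dir O)
      (fun _ => 1) (by simp)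
      (fun i s => by simp [arnoldSign, hr, gradedSign_of_not_odd hr, pow_succ])
      (fun s => by simp [arnoldSign, hr])
      (fun s => by
        by_cases h : O.tail s.edge = s.src <;>
          simp [stepGen, Step.dir, h, gradedSign_of_not_odd hr]) w
    exact ⟨-1 * k, by rw [mul_mul_mul_comm, hk]; rfl, h⟩

theorem toConf_eq_zero_of_mem_arnoldIdeal (r : ℕ) (hG : G.Loopless) (o : Odd r → Orientation G)
    (O : Orientation G) (hO : ∀ h, o h = O) {x : Lambda r E(G)} (hx : x ∈ arnoldIdeal r G o) :
    toConf r O.tail O.head x = 0 := by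
  have key : arnoldIdeal r G o ≤ TwoSidedIdeal.ker (toConf r O.tail O.head) := by
    refine TwoSidedIdeal.span_le.2 ?_
    rintro _ ⟨w, hw, rfl⟩
    obtain ⟨hne, a, ha⟩ := hw.walk O
    obtain ⟨k, -, hk⟩ := exists_arnoldClass_eq r o O hO w
    have hne' : w.map (Step.dir O) ≠ [] := by simpa using hne
    have hmem := boundary_mul_mem_circuitIdeal (q := gradedSign r) (x := gen r) (S := Set.univ)
      hne' ha (fun _ _ => trivial) (one_mem _)
    rw [mul_one] at hmem
    rw [SetLike.mem_coe, TwoSidedIdeal.mem_ker, hk, map_zsmul,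
      map_eq_zero_of_mem_circuitIdeal (toConf r O.tail O.head) (toConf_gen r O.tail O.head)
        (fun e _ => (O.isLink e).ne) hmem, zsmul_zero]
  exact (TwoSidedIdeal.mem_ker _).1 (key hx)

/-- The direction is recovered from the starting vertex, which would be impossible for a loop. -/
theorem dir_dirStep (hG : G.Loopless) (O : Orientation G) (y : E(G) × Bool) :
    (dirStep O y).dir O = y := by
  obtain ⟨e, _ | _⟩ := y
  · simp [Step.dir, dirStep, stepSrc, (O.isLink e).ne]
  · simp [Step.dir, dirStep, stepSrc]

theorem mem_arnoldIdeal_of_mem_circuitIdeal (r : ℕ) (hG : G.Loopless)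
    (o : Odd r → Orientation G) (O : Orientation G) (hO : ∀ h, o h = O) {S : Set E(G)}
    {x : Lambda r E(G)}
    (hx : x ∈ circuitIdeal (gradedSign r) O.tail O.head (gen r) S) : x ∈ arnoldIdeal r G o := by
  induction hx using AddSubgroup.closure_induction with
  | mem z h =>
    obtain ⟨a, w, hne, hw, -, m, -, rfl⟩ := h
    refine TwoSidedIdeal.mul_mem_right _ _ _ ?_
    obtain ⟨k, hk, h⟩ := exists_arnoldClass_eq r o O hO (w.map (dirStep O))
    have hid : (w.map (dirStep O)).map (Step.dir O) = w := by
      rw [List.map_map, show Step.dir O ∘ dirStep O = id from funext (dir_dirStep hG O), List.map_id]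
    rw [hid] at h
    have h' := TwoSidedIdeal.zsmul_mem (arnoldIdeal r G o) k
      (TwoSidedIdeal.subset_span ⟨_, hw.isCircuit O hne, rfl⟩)
    rwa [h, ← mul_zsmul, hk, one_zsmul] at h'
  | zero => exact TwoSidedIdeal.zero_mem _
  | add y z _ _ hy hz => exact TwoSidedIdeal.add_mem _ hy hz
  | neg z _ hz => exact TwoSidedIdeal.neg_mem _ hz

theorem exists_orientation (G : Graph α β) : Nonempty (Orientation G) := by
  have h : ∀ e : E(G), ∃ a b, G.IsLink e a b := fun e => G.exists_isLink_of_mem_edgeSet e.2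
  choose a b h using h
  exact ⟨⟨a, b, h⟩⟩

theorem toConf_lambdaMap (r : ℕ) {E F : Type v} (f : E → F) (s t : F → α) (x : Lambda r E) :
    toConf r s t (lambdaMap r f x) = toConf r (s ∘ f) (t ∘ f) x := by
  have h : (toConf r s t).comp (lambdaMap r f) = toConf r (s ∘ f) (t ∘ f) :=
    lambdaHom_ext fun a => by simp [toConf_gen]
  exact RingHom.congr_fun h x

/-- For a loopless graph, the ring `R^r` embeds in the Arnold ring of the configurations of the
vertices. -/
theorem mem_arnoldIdeal_iff (r : ℕ) (hG : G.Loopless) (o : Odd r → Orientation G)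
    (O : Orientation G) (hO : ∀ h, o h = O) {x : Lambda r E(G)} :
    x ∈ arnoldIdeal r G o ↔ toConf r O.tail O.head x = 0 := by
  refine ⟨toConf_eq_zero_of_mem_arnoldIdeal r hG o O hO, fun h => ?_⟩
  obtain ⟨S, hS, hx⟩ := exists_finite_mem_edgeSubring r x
  exact mem_arnoldIdeal_of_mem_circuitIdeal r hG o O hO
    (mem_circuitIdeal_of_map_eq_zero (gradedSign_mul_self r) (gen_mul_gen r) (gen_sq r)
      (toConf r) (toConf_gen r) hS O.tail O.head hx h)

end Graphs

end GraphRing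

end

theorem mainTheorem4 {α : Type*} {β : Type*} (r : ℕ) (Γ Γ' : Graph α β) (hloop : Γ.Loopless)
    (o : Odd r → GraphRing.Orientation Γ) (hsub : Γ' ≤ Γ) (hV : V(Γ') = V(Γ)) :
    Function.Injective (GraphRing.inclusionMap r o hsub) := by
  -- For even `r` no orientation is given and any choice serves to define the map to `Conf`.
  obtain ⟨O, hO⟩ : ∃ O : GraphRing.Orientation Γ, ∀ h, o h = O := by
    by_cases hr : Odd r
    · exact ⟨o hr, fun _ => rfl⟩
    · exact ⟨(GraphRing.exists_orientation Γ).some, fun h => absurd h hr⟩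
  refine (injective_iff_map_eq_zero _).2 fun y hy => ?_
  obtain ⟨x, rfl⟩ := RingCon.mk'_surjective _ y
  have hx : GraphRing.lambdaMap r (Set.inclusion hsub.edgeSet_mono) x ∈
      GraphRing.arnoldIdeal r Γ o := by
    rw [TwoSidedIdeal.mem_iff]
    exact (RingCon.eq _).1 hy
  -- Both ideals are now kernels of maps to the same ring `Conf`, and these maps agree on `Λ^r(Γ')`.
  rw [GraphRing.mem_arnoldIdeal_iff r hloop o O hO, GraphRing.toConf_lambdaMap] at hx
  have hx' : x ∈ GraphRing.arnoldIdeal r Γ' fun hr => (o hr).restrict hsub :=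
    (GraphRing.mem_arnoldIdeal_iff r (hloop.anti hsub) _ (O.restrict hsub)
      fun h => by rw [hO h]).2 hx
  exact (RingCon.eq _).2 ((TwoSidedIdeal.mem_iff _ _).1 hx')
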